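/- Let $\overline{\mathbb D}=\{z\in\mathbb C:|z|\le 1\}$ and let $C(\overline{\mathbb D})$ be the space of continuous functions $\overline{\mathbb D}\to\mathbb C$ with the supremum norm. Let $\tau_p$ denote the topology of pointwise convergence on $C(\overline{\mathbb D})$. If $T:C(\overline{\mathbb D})\to C(\overline{\mathbb D})$ is a ($\mathbb C$-linear) surjective isometry, then $T$ is not $\tau_p$-supercyclic; that is, there is no $f\in C(\overline{\mathbb D})$ for which the set $\{\lambda T^n f:\lambda\in\mathbb C,\ n=0,1,2,\dots\}$ is dense in $(C(\overline{\mathbb D}),\tau_p)$. -/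

import Mathlib

/-- The topology of pointwise convergence on the space `C(X, ℂ)` of continuous
complex-valued functions on `X`: the topology induced by the product topology on `X → ℂ`. -/
noncomputable abbrev pointwiseTopology (X : Type*) [TopologicalSpace X] : TopologicalSpace C(X, ℂ) :=
  TopologicalSpace.induced (fun (f : C(X, ℂ)) (x : X) => f x) Pi.topologicalSpace

/-- The projective orbit `{λ Tⁿ f : λ ∈ ℂ, n = 0, 1, …}` of a vector `f` under `T`. -/
def projectiveOrbit {F : Type*} [AddCommGroup F] [Module ℂ F] (T : F →ₗ[ℂ] F) (f : F) : Set F :=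
  {g | ∃ (c : ℂ) (n : ℕ), g = c • T^[n] f}

/-- A linear operator `T` on `F` is supercyclic with respect to a topology `τ` on `F` if the
projective orbit of some vector is `τ`-dense in `F`. -/
def IsSupercyclic {F : Type*} [AddCommGroup F] [Module ℂ F] (τ : TopologicalSpace F)
    (T : F →ₗ[ℂ] F) : Prop :=
  ∃ f : F, @Dense F τ (projectiveOrbit T f)

/-- The closed unit disc of the complex plane, as a (compact) topological space. -/
abbrev ClosedDisc : Type := Metric.closedBall (0 : ℂ) 1

/-! ### Fixed points of continuous self-maps of the closed disc -/

/-! By Banach–Stone, `T f = w · (f ∘ σ)` with `|w| = 1`; on the disc `σ` is continuous, so Brouwer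
gives `σ z = z` and `T f z = w z * f z`. Hence `|Tⁿ f z| = |f z|`, while `‖Tⁿ f‖ = ‖f‖`. Every `g =
λ Tⁿ f` thus satisfies `|f z| |g x| ≤ ‖f‖ |g z|` for all `x`, a pointwise closed condition. If `f z
≠ 0`, it fails for a `g` with `g z = 0 ≠ g x`; if `f z = 0`, the whole projective orbit vanishes at
`z`. -/

/-- The identity map of the circle has no continuous logarithm. -/
theorem not_exists_continuous_log_circle {G : ℝ → ℂ} (hG : Continuous G)
    (hexp : ∀ t : ℝ, Complex.exp (G t) = Complex.exp (t * Complex.I)) :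
    G (2 * Real.pi) ≠ G 0 := by
  intro hper
  have hint : ∀ t : ℝ, ∃ n : ℤ, G t = t * Complex.I + n * (2 * Real.pi * Complex.I) := fun t ↦
    Complex.exp_eq_exp_iff_exists_int.mp (hexp t)
  -- `r` is continuous and integer-valued, yet periodicity of `G` makes it drop by one over a full
  -- turn, so it would take a half-integer value.
  set r : ℝ → ℝ := fun t ↦ ((G t).im - t) / (2 * Real.pi) with hr
  have hrcont : Continuous r := by fun_prop
  have hrint : ∀ t, ∃ n : ℤ, r t = n := by
    intro t
    obtain ⟨n, hn⟩ := hint t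
    refine ⟨n, ?_⟩
    have him : (G t).im = t + n * (2 * Real.pi) := by simp [hn]
    simp only [hr, him]
    field_simp
    ring
  have hr2 : r (2 * Real.pi) = r 0 - 1 := by
    simp only [hr, hper]
    field_simp
    ring
  have hmem : r 0 - 1 / 2 ∈ Set.Icc (r (2 * Real.pi)) (r 0) := by
    rw [hr2]; constructor <;> linarith
  obtain ⟨t, -, ht⟩ :=
    intermediate_value_Icc' Real.two_pi_pos.le hrcont.continuousOn hmem
  obtain ⟨m, hm⟩ := hrint t
  obtain ⟨n, hn⟩ := hrint 0
  have h : ((2 * m : ℤ) : ℝ) = ((2 * n - 1 : ℤ) : ℝ) := by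
    push_cast
    linarith
  have := Int.cast_injective h
  omega

/-- A nowhere vanishing continuous function on a convex subset of `ℂ` has a continuous
logarithm. -/
theorem Convex.exists_continuous_exp_eq {S : Set ℂ} (hS : Convex ℝ S) (hne : S.Nonempty)
    {h : S → ℂ} (hh : Continuous h) (h0 : ∀ z, h z ≠ 0) :
    ∃ L : S → ℂ, Continuous L ∧ ∀ z, Complex.exp (L z) = h z := by
  have := hS.contractibleSpace hne
  have := hS.locallyPathConnectedSpace
  obtain ⟨L, ⟨-, hL⟩, -⟩ := Complex.isCoveringMapOn_exp.existsUnique_continuousMap_lifts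
    ⟨h, hh⟩ (a₀ := ⟨hne.some, hne.some_mem⟩) (Complex.exp_log (h0 _)) h0
  exact ⟨L, L.continuous, fun z ↦ congr_fun hL z⟩

/-- **Brouwer's fixed point theorem** for the closed unit disc of the complex plane. -/
theorem ClosedDisc.exists_fixedPoint {φ : ClosedDisc → ClosedDisc} (hφ : Continuous φ) :
    ∃ z, φ z = z := by
  by_contra! hne
  obtain ⟨L, hLc, hL⟩ := (convex_closedBall (0 : ℂ) 1).exists_continuous_exp_eq
    (Metric.nonempty_closedBall.mpr zero_le_one)
    (h := fun z : ClosedDisc ↦ (z : ℂ) - φ z) (by fun_prop)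
    fun z hz ↦ hne z (Subtype.ext (sub_eq_zero.mp hz).symm)
  let e : ℝ → ClosedDisc := fun t ↦ ⟨Complex.exp (t * Complex.I), by simp⟩
  have he : Continuous e := by fun_prop
  -- On the circle `e - φ(e) = e * u`. Since `|1 - u| ≤ 1` and `u ≠ 0`, `u` avoids the cut of the
  -- principal logarithm, so `L - log u` would be a continuous logarithm of `e`.
  let u : ℝ → ℂ := fun t ↦ 1 - φ (e t) * Complex.exp (-(t * Complex.I))
  have hu : Continuous u := by fun_prop
  have hfac : ∀ t : ℝ, Complex.exp (t * Complex.I) * u t = e t - φ (e t) := by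
    intro t
    simp only [u, e, Complex.exp_neg]
    field_simp [Complex.exp_ne_zero]
  have hu0 : ∀ t, u t ≠ 0 := by
    intro t ht
    have := hfac t
    rw [ht, mul_zero] at this
    exact hne (e t) (Subtype.ext (sub_eq_zero.mp this.symm).symm)
  have hslit : ∀ t, u t ∈ Complex.slitPlane := by
    intro t
    set a : ℂ := φ (e t) * Complex.exp (-(t * Complex.I)) with ha
    have hnorm : ‖a‖ ≤ 1 := by
      have h1 : ‖Complex.exp (-(t * Complex.I))‖ = 1 := by simp [Complex.norm_exp]
      rw [ha, norm_mul, h1, mul_one]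
      exact mem_closedBall_zero_iff.mp (φ (e t)).2
    have ha1 : a ≠ 1 := fun h ↦ hu0 t (by simp only [u]; rw [← ha, h, sub_self])
    rw [Complex.mem_slitPlane_iff]
    by_contra! hcon
    obtain ⟨hre, him⟩ := hcon
    simp only [u, ← ha, Complex.sub_re, Complex.one_re, Complex.sub_im, Complex.one_im] at hre him
    have := (Complex.re_le_norm a).trans hnorm
    exact ha1 (Complex.ext (by simp; linarith) (by simp; linarith))
  refine not_exists_continuous_log_circle (G := fun t ↦ L (e t) - Complex.log (u t))
    ((hLc.comp he).sub (hu.clog hslit)) (fun t ↦ ?_) ?_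
  · rw [Complex.exp_sub, hL, Complex.exp_log (hu0 t), ← hfac, mul_div_cancel_right₀ _ (hu0 t)]
  · have h2 : e (2 * Real.pi) = e 0 := Subtype.ext (by simp [e])
    have hu2 : u (2 * Real.pi) = u 0 := by
      simp only [u, h2]
      simp [Complex.exp_neg]
    simp only [h2, hu2]

/-! ### Linear isometries of spaces of continuous functions -/

section Isometries

variable {X : Type*} [TopologicalSpace X] [CompactSpace X]

theorem ContinuousMap.exists_norm_apply_eq_norm {E : Type*} [SeminormedAddCommGroup E]
    [Nonempty X] (f : C(X, E)) : ∃ x, ‖f x‖ = ‖f‖ := by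
  obtain ⟨x, hx⟩ := (map_continuous f).norm.exists_forall_ge_of_hasCompactSupport
    (HasCompactSupport.of_compactSpace _)
  exact ⟨x, le_antisymm (f.norm_coe_le_norm x) ((f.norm_le (norm_nonneg _)).mpr hx)⟩

/-- Two points of the unit circle whose sum has norm two coincide. -/
theorem Complex.eq_of_norm_add_eq_two {a b : ℂ} (ha : ‖a‖ = 1) (hb : ‖b‖ = 1)
    (hab : ‖a + b‖ = 2) : a = b :=
  eq_of_norm_eq_of_norm_add_eq (ha.trans hb.symm) (by rw [hab, ha, hb]; norm_num)

/-- A linear isometry of `C(X, ℂ)` norms at a common point all functions which attain their norm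
at `x` with a nonnegative value. -/
theorem LinearIsometry.exists_forall_norm_apply_eq [Nonempty X]
    (S : C(X, ℂ) →ₗᵢ[ℂ] C(X, ℂ)) (x : X) :
    ∃ y, ∀ g : C(X, ℂ), g x = ‖g‖ → ‖S g y‖ = ‖g‖ := by
  have hadd : ∀ f g : C(X, ℂ), f x = ‖f‖ → g x = ‖g‖ → ‖f + g‖ = ‖f‖ + ‖g‖ := by
    intro f g hf hg
    refine le_antisymm (norm_add_le f g) ?_
    have h : ‖(f + g) x‖ = ‖f‖ + ‖g‖ := by
      rw [ContinuousMap.add_apply, hf, hg, ← Complex.ofReal_add, Complex.norm_real,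
        Real.norm_of_nonneg (by positivity)]
    exact h ▸ (f + g).norm_coe_le_norm x
  -- Where `S (f + g)` attains `‖f‖ + ‖g‖`, both `S f` and `S g` attain their norms. The family is
  -- therefore directed, and compactness gives a common point.
  let K : {g : C(X, ℂ) // g x = ‖g‖} → Set X := fun g ↦ {y | ‖S g y‖ = ‖(g : C(X, ℂ))‖}
  have hKclosed : ∀ g, IsClosed (K g) := fun g ↦
    isClosed_eq (map_continuous (S g)).norm continuous_const
  have : Nonempty {g : C(X, ℂ) // g x = ‖g‖} := ⟨0, by simp⟩
  have hdir : Directed (· ⊇ ·) K := by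
    rintro ⟨f, hf⟩ ⟨g, hg⟩
    have hsum := hadd f g hf hg
    refine ⟨⟨f + g, by rw [hsum, ContinuousMap.add_apply, hf, hg, Complex.ofReal_add]⟩, ?_, ?_⟩ <;>
    · intro y hy
      have hy' : ‖S (f + g) y‖ = ‖f + g‖ := hy
      rw [map_add, ContinuousMap.add_apply, hsum] at hy'
      have h := norm_add_le (S f y) (S g y)
      have h1 := ((S f).norm_coe_le_norm y).trans_eq (S.norm_map f)
      have h2 := ((S g).norm_coe_le_norm y).trans_eq (S.norm_map g)
      simp only [K, Set.mem_ofPred_eq]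
      linarith
  obtain ⟨y, hy⟩ := IsCompact.nonempty_iInter_of_directed_nonempty_isCompact_isClosed K hdir
    (fun g ↦ by
      obtain ⟨y, hy⟩ := (S g).exists_norm_apply_eq_norm
      exact ⟨y, hy.trans (S.norm_map g)⟩)
    (fun g ↦ (hKclosed g).isCompact) hKclosed
  exact ⟨y, fun g hg ↦ Set.mem_iInter.mp hy ⟨g, hg⟩⟩

/-- The adjoint of a linear isometry of `C(X, ℂ)` maps some point evaluation to a unimodular
multiple of the evaluation at a prescribed point. -/
theorem LinearIsometry.exists_apply_eq_mul_apply (S : C(X, ℂ) →ₗᵢ[ℂ] C(X, ℂ)) (x : X) :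
    ∃ (y : X) (c : ℂ), ‖c‖ = 1 ∧ ∀ g, S g y = c * g x := by
  have : Nonempty X := ⟨x⟩
  obtain ⟨y, hy⟩ := S.exists_forall_norm_apply_eq x
  have hunit : ∀ g : C(X, ℂ), g x = 1 → ‖g‖ = 1 → S g y = S 1 y := by
    intro g hgx hg
    have h1 : ‖(1 : C(X, ℂ))‖ = 1 := norm_one
    have hsum : ‖g + 1‖ = 2 := by
      refine le_antisymm ((norm_add_le _ _).trans (by rw [hg, h1]; norm_num)) ?_
      have h : ‖(g + 1) x‖ = 2 := by simp [hgx]; norm_num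
      exact h ▸ (g + 1).norm_coe_le_norm x
    refine Complex.eq_of_norm_add_eq_two ((hy g (by simp [hgx, hg])).trans hg)
      ((hy 1 (by simp)).trans h1) ?_
    rw [← ContinuousMap.add_apply, ← map_add, hy, hsum]
    rw [hsum, ContinuousMap.add_apply, hgx]
    norm_num
  have hzero_of_le : ∀ g : C(X, ℂ), g x = 0 → ‖g‖ ≤ 1 → S g y = 0 := by
    intro g hgx hg
    -- Both `h = 1 - |g|` and `h + g` have norm 1 and value 1 at `x`, so `hunit` gives their images
    -- the same value at `y`; subtracting kills `S g y`.
    let h : C(X, ℂ) := ⟨fun z ↦ ((1 - ‖g z‖ : ℝ) : ℂ), by fun_prop⟩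
    have hhx : h x = 1 := by simp [h, hgx]
    have hh : ∀ z, ‖h z‖ = 1 - ‖g z‖ := fun z ↦ by
      simp only [h, ContinuousMap.coe_mk, Complex.norm_real]
      exact Real.norm_of_nonneg (sub_nonneg.mpr ((g.norm_coe_le_norm z).trans hg))
    have hnorm : ∀ k : C(X, ℂ), k x = 1 → (∀ z, ‖k z‖ ≤ 1) → ‖k‖ = 1 := fun k hk hk1 ↦
      le_antisymm ((k.norm_le zero_le_one).mpr hk1) (by
        simpa [hk] using k.norm_coe_le_norm x)
    have e1 := hunit h hhx (hnorm h hhx fun z ↦ by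
      rw [hh]; linarith [norm_nonneg (g z)])
    have hsumx : (h + g) x = 1 := by simp [hhx, hgx]
    have e2 := hunit (h + g) hsumx (hnorm _ hsumx fun z ↦ by
      rw [ContinuousMap.add_apply]
      linarith [norm_add_le (h z) (g z), hh z])
    rw [map_add, ContinuousMap.add_apply, e1] at e2
    simpa using e2
  have hzero : ∀ g : C(X, ℂ), g x = 0 → S g y = 0 := by
    intro g hgx
    rcases eq_or_ne g 0 with rfl | hg
    · simp
    have h := hzero_of_le ((‖g‖⁻¹ : ℂ) • g) (by simp [hgx])
      (by rw [norm_smul]; simp [hg])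
    simpa [hg] using h
  refine ⟨y, S 1 y, (hy 1 (by simp)).trans norm_one, fun g ↦ ?_⟩
  have h := hzero (g - g x • 1) (by simp)
  rw [map_sub, map_smul] at h
  simpa [sub_eq_zero, mul_comm] using h

/-- **Banach–Stone**: a surjective linear isometry of `C(X, ℂ)` is a weighted composition
operator. -/
theorem LinearIsometryEquiv.exists_apply_eq_mul_apply (T : C(X, ℂ) ≃ₗᵢ[ℂ] C(X, ℂ)) :
    ∃ (w : X → ℂ) (σ : X → X), (∀ x, ‖w x‖ = 1) ∧ ∀ f x, T f x = w x * f (σ x) := by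
  -- The inverse is used because its point relation, applied to `T f`, expresses `f (σ x)` through
  -- `T f x`.
  choose σ c hc hσ using T.symm.toLinearIsometry.exists_apply_eq_mul_apply
  refine ⟨fun x ↦ (c x)⁻¹, σ, fun x ↦ by simp [hc], fun f x ↦ ?_⟩
  have h : f (σ x) = c x * T f x := by simpa using hσ x (T f)
  have hc0 : c x ≠ 0 := norm_ne_zero_iff.mp (by simp [hc])
  rw [h, inv_mul_cancel_left₀ hc0]

end Isometries

/-- Every surjective linear isometry of `C(𝔻̄)` has an evaluation at some point of the disc as an
eigenvector of its adjoint, with unimodular eigenvalue. -/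
theorem ClosedDisc.exists_isometry_eigenpoint (T : C(ClosedDisc, ℂ) ≃ₗᵢ[ℂ] C(ClosedDisc, ℂ)) :
    ∃ (z : ClosedDisc) (c : ℂ), ‖c‖ = 1 ∧ ∀ f, T f z = c * f z := by
  obtain ⟨w, σ, hw, hT⟩ := T.exists_apply_eq_mul_apply
  have hw0 : ∀ x, w x ≠ 0 := fun x ↦ norm_ne_zero_iff.mp (by simp [hw])
  have hwT : w = T 1 := funext fun x ↦ by simp [hT]
  -- The coordinate function recovers `σ` as `T ι / T 1`, whence its continuity.
  let ι : C(ClosedDisc, ℂ) := ⟨Subtype.val, continuous_subtype_val⟩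
  have hσ : Continuous σ := by
    refine continuous_induced_rng.mpr ?_
    have h : Subtype.val ∘ σ = fun x ↦ T ι x / w x := funext fun x ↦ by
      rw [hT, mul_div_cancel_left₀ _ (hw0 x)]; rfl
    rw [h]
    exact (map_continuous (T ι)).div (hwT ▸ map_continuous (T 1)) hw0
  obtain ⟨z, hz⟩ := ClosedDisc.exists_fixedPoint hσ
  exact ⟨z, w z, hw z, fun f ↦ by rw [hT, hz]⟩

/-- An isometric operator on `C(X, ℂ)` whose adjoint multiplies some point evaluation by a
unimodular number is not supercyclic for the topology of pointwise convergence, provided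
that some continuous function vanishes at that point but not identically. -/
theorem not_isSupercyclic_pointwiseTopology {X : Type*} [TopologicalSpace X] [CompactSpace X]
    {T : C(X, ℂ) →ₗ[ℂ] C(X, ℂ)} (hT : Isometry T) {z : X} {c : ℂ} (hc : ‖c‖ = 1)
    (hz : ∀ f, T f z = c * f z) {g : C(X, ℂ)} (hgz : g z = 0) {x : X} (hgx : g x ≠ 0) :
    ¬ IsSupercyclic (pointwiseTopology X) T := by
  rintro ⟨f, hf⟩
  have hnorm : ∀ n : ℕ, ‖T^[n] f‖ = ‖f‖ := fun n ↦ by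
    induction n with
    | zero => rfl
    | succ n ih =>
      rw [Function.iterate_succ_apply', ← ih]
      simpa using hT.dist_eq (T^[n] f) 0
  have hiter : ∀ n : ℕ, ‖T^[n] f z‖ = ‖f z‖ := fun n ↦ by
    induction n with
    | zero => rfl
    | succ n ih => rw [Function.iterate_succ_apply', hz, norm_mul, hc, one_mul, ih]
  have hmem : ∀ U : Set (X → ℂ), IsOpen U → (∃ g : C(X, ℂ), ⇑g ∈ U) →
      ∃ (a : ℂ) (n : ℕ), (fun y ↦ a * T^[n] f y) ∈ U := by
    rintro U hU ⟨g, hg⟩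
    obtain ⟨k, hkU, a, n, rfl⟩ :=
      @Dense.inter_open_nonempty _ (pointwiseTopology X) _ hf
      ((fun (f : C(X, ℂ)) (x : X) ↦ f x) ⁻¹' U) (@isOpen_induced _ _ (_) _ _ hU) ⟨g, hg⟩
    exact ⟨a, n, hkU⟩
  by_cases hfz : f z = 0
  · obtain ⟨a, n, h⟩ := hmem {g | g z ≠ 0} (isOpen_ne_fun (continuous_apply z) continuous_const)
      ⟨1, by simp⟩
    exact h (mul_eq_zero_of_right _ (norm_eq_zero.mp (by rw [hiter, hfz, norm_zero])))
  -- This open set contains the given `g` because `g z = 0`, but no multiple of an iterate of `f`.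
  · obtain ⟨a, n, h⟩ := hmem {g | ‖f‖ * ‖g z‖ < ‖f z‖ * ‖g x‖}
      (isOpen_lt (by fun_prop) (by fun_prop)) ⟨g, by simpa [hgz, hgx] using hfz⟩
    simp only [Set.mem_ofPred_eq, norm_mul, hiter] at h
    have hle : ‖T^[n] f x‖ ≤ ‖f‖ := ((T^[n] f).norm_coe_le_norm x).trans_eq (hnorm n)
    have := mul_le_mul_of_nonneg_left hle (mul_nonneg (norm_nonneg (f z)) (norm_nonneg a))
    linarith

/-- No surjective linear isometry of `C(𝔻̄)`, with the supremum norm, is supercyclic with respect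
to the topology of pointwise convergence. -/
theorem theorem4p8 (T : C(ClosedDisc, ℂ) →ₗ[ℂ] C(ClosedDisc, ℂ))
    (hT : Isometry T) (hsurj : Function.Surjective T) :
    ¬ IsSupercyclic (pointwiseTopology ClosedDisc) T := by
  obtain ⟨z, c, hc, hz⟩ := ClosedDisc.exists_isometry_eigenpoint
    (LinearIsometryEquiv.ofSurjective ⟨T, fun f ↦ by simpa using hT.dist_eq f 0⟩ hsurj)
  obtain ⟨x, hx⟩ : ∃ x : ClosedDisc, x ≠ z := by
    by_cases h : (⟨0, by simp⟩ : ClosedDisc) = z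
    · refine ⟨⟨1, by simp⟩, fun h1 ↦ ?_⟩
      simpa using congrArg Subtype.val (h1.trans h.symm)
    · exact ⟨_, h⟩
  exact not_isSupercyclic_pointwiseTopology hT hc hz
    (g := ⟨fun y ↦ (y : ℂ) - z, by fun_prop⟩) (by simp) (x := x)
    (sub_ne_zero.mpr fun h ↦ hx (Subtype.ext h))
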